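/- For $n\ge 1$ let $\mathcal P(n)$ be the set of all partitions of $\{1,\dots,n\}$ into nonempty blocks, and let $|\pi|$ denote the number of blocks of $\pi$. For a real random variable $X$ with $\mathsf E|X|^n<\infty$, the $n$-th cumulant is $$\kappa_n(X)=\sum_{\pi\in\mathcal P(n)}(-1)^{|\pi|-1}(|\pi|-1)!\prod_{B\in\pi}\mathsf E\bigl[X^{|B|}\bigr].$$ Let $C_n^{\mathrm{cen}}=\sum_{\pi}(|\pi|-1)!$, where the sum runs over those $\pi\in\mathcal P(n)$ all of whose blocks have at least two elements, and let $\rho_{\mathrm{cen}}>0$ be the unique positive solution of $e^{\rho}=2+\rho$. Corollary 8.4 (Tail bound from the centered refinement). One has $C_n^{\mathrm{cen}}\sim (n-1)!/\rho_{\mathrm{cen}}^{\,n}$ as $n\to\infty$. Moreover, there is an absolute constant $A_{\mathrm{cen}}\ge 1$ (depending only on the sequence $(C_n^{\mathrm{cen}})_n$) such that the following holds for every real random variable $X$ with $\mathsf E[X]=0$ and finite variance $\mathsf{Var}[X]=v>0$. (a) For every $n\ge 2$ with $\mathsf E|X|^n<\infty$, $\;|\kappa_n(X)|\le C_n^{\mathrm{cen}}\,\mathsf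 E|X|^n$. (b) Suppose that there is $L>0$ such that $\mathsf E|X|^n<\infty$ and $\mathsf E|X|^n\le v\,L^{n-2}$ for all $n\ge 2$. Put $$v'=\frac{A_{\mathrm{cen}}\,v}{\rho_{\mathrm{cen}}^2},\qquad b=\frac{L}{\rho_{\mathrm{cen}}}.$$ Then $$|\kappa_n(X)|\le (n-1)!\,v'\,b^{\,n-2}\quad\text{for all } n\ge 2,$$ and $$\mathsf P(|X|\ge x)\le 2\exp\Bigl(-\frac{x^2}{2(v'+bx)}\Bigr)\quad\text{for all } x>0.$$ -/

import Mathlib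

open MeasureTheory ProbabilityTheory Filter

namespace CumulantBounds

/-- The `n`-th cumulant of `X` (for `n ≥ 1` and `E|X|^n < ∞`), given by the moment-cumulant formula:
the sum over all set partitions `π` of an `n`-element set of
`(-1)^(|π|-1) (|π|-1)! ∏_{B ∈ π} E[X^|B|]`. -/
noncomputable def cumulant {Ω : Type*} [MeasurableSpace Ω] (X : Ω → ℝ) (n : ℕ) (μ : Measure Ω) : ℝ :=
  ∑ π : Finpartition (Finset.univ : Finset (Fin n)),
    (-1 : ℝ) ^ (π.parts.card - 1) * ((π.parts.card - 1).factorial : ℝ) *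
      ∏ B ∈ π.parts, moment X B.card μ

/-- The centered refinement coefficient (for `n ≥ 1`): the sum of `(|π|-1)!` over all set
partitions `π` of an `n`-element set in which every block has at least two elements. -/
def Ccen (n : ℕ) : ℕ :=
  ∑ π : Finpartition (Finset.univ : Finset (Fin n)) with ∀ B ∈ π.parts, 2 ≤ B.card,
    (π.parts.card - 1).factorial

/-- The equation `e^ρ = 2 + ρ` has exactly one positive solution. -/
theorem existsUnique_rhoCen : ∃! ρ : ℝ, 0 < ρ ∧ Real.exp ρ = 2 + ρ := by
  have hmono : StrictMonoOn (fun x : ℝ => Real.exp x - x) (Set.Ici 0) := by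
    apply strictMonoOn_of_deriv_pos (convex_Ici 0) (by fun_prop)
    intro x hx
    rw [interior_Ici] at hx
    have h : HasDerivAt (fun x : ℝ => Real.exp x - x) (Real.exp x - 1) x :=
      (Real.hasDerivAt_exp x).sub (hasDerivAt_id x)
    rw [h.deriv]
    have := Real.one_lt_exp_iff.mpr (Set.mem_Ioi.mp hx)
    linarith
  have h2 : (2 : ℝ) ≤ Real.exp 2 - 2 := by
    have := Real.quadratic_le_exp_of_nonneg (x := 2) (by norm_num)
    linarith
  obtain ⟨ρ, hρ, hρe⟩ := intermediate_value_Icc (f := fun x : ℝ => Real.exp x - x)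
    (a := 0) (b := 2) (by norm_num) (by fun_prop) ⟨by simp, h2⟩
  have hρe : Real.exp ρ - ρ = 2 := hρe
  have h0 : ρ ≠ 0 := by
    rintro rfl
    norm_num at hρe
  refine ⟨ρ, ⟨lt_of_le_of_ne hρ.1 h0.symm, by linarith⟩, ?_⟩
  rintro y ⟨hy, hye⟩
  apply hmono.injOn (Set.mem_Ici.mpr hy.le) (Set.mem_Ici.mpr hρ.1)
  change Real.exp y - y = Real.exp ρ - ρ
  linarith

/-- The unique positive solution of `e^ρ = 2 + ρ`. -/
noncomputable def rhoCen : ℝ := existsUnique_rhoCen.choose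

theorem rhoCen_pos : 0 < rhoCen := existsUnique_rhoCen.choose_spec.1.1

theorem exp_rhoCen : Real.exp rhoCen = 2 + rhoCen := existsUnique_rhoCen.choose_spec.1.2

end CumulantBounds

/-!
`Ccen n` counts partitions together with a cyclic order of their blocks, so by the exponential
formula `Ccen (n + 1)` is `n!` times the `n`-th Taylor coefficient at `0` of the derivative of
`-log (2 + z - exp z)`. The pole of this derivative closest to the origin is the simple pole `ρ`,
with residue `-1`, which yields the asymptotics `(n - 1)! / ρ ^ n`.

A centred variable has no contribution from partitions with singleton blocks, and by Lyapunov's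
inequality each remaining product of moments is at most `E|X|^n`, so `|κₙ| ≤ Ccen n * E|X|^n`.
Since `1 ≤ Ccen n ≤ A (n - 1)! / ρ ^ n`, the moment hypothesis of part (b) is stronger than
Bernstein's moment condition with parameters `v'` and `b`; summing the exponential series bounds the
moment generating function by `exp (v' t² / (2 (1 - b |t|)))`, and Chernoff's bound at
`t = x / (v' + b x)` is the claimed tail.
-/

namespace CumulantBounds

open scoped Nat Topology
open Metric

section SetPartitions

variable {α : Type*} [DecidableEq α] {s B : Finset α} {a : α} (p : ℕ → Prop) [DecidablePred p]

/-- The number of set partitions of `s` with all block sizes in `p`, together with a cyclic order of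
the blocks; a partition into `k ≥ 1` blocks has `(k - 1)!` of these. -/
def cyclicPartitionCount (s : Finset α) : ℕ :=
  ∑ π : Finpartition s with ∀ B ∈ π.parts, p B.card, (π.parts.card - 1)!

lemma sup_erase_parts (π : Finpartition s) (hB : B ∈ π.parts) :
    (π.parts.erase B).sup id = s \ B := by
  have union_eq : B ∪ (π.parts.erase B).sup id = s :=
    Finset.sup_insert.symm.trans (by rw [Finset.insert_erase hB, π.sup_parts])
  have disjoint : Disjoint B ((π.parts.erase B).sup id) :=
    π.supIndep (Finset.erase_subset B _) hB (Finset.notMem_erase B _)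
  rw [← Finset.union_sdiff_cancel_left disjoint, union_eq]

lemma sum_partitions_with_block {M : Type*} [AddCommMonoid M] (f : ℕ → M) (hBs : B ⊆ s)
    (hB : B.Nonempty) (hpB : p B.card) :
    ∑ π : Finpartition s with (∀ C ∈ π.parts, p C.card) ∧ B ∈ π.parts, f π.parts.card =
      ∑ σ : Finpartition (s \ B) with ∀ C ∈ σ.parts, p C.card, f (σ.parts.card + 1) := by
  have notMem (σ : Finpartition (s \ B)) : B ∉ σ.parts := fun h =>
    hB.ne_empty (Finset.disjoint_self_iff_empty B |>.mp
      (Finset.disjoint_sdiff.mono_right (σ.subset h)))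
  refine Finset.sum_bij'
    (fun π hπ => π.ofSubset (Finset.erase_subset B π.parts)
      (sup_erase_parts π (Finset.mem_filter.mp hπ).2.2))
    (fun σ _ => σ.extend hB.ne_empty Finset.sdiff_disjoint (Finset.sdiff_union_of_subset hBs))
    ?_ ?_ ?_ ?_ ?_
  · intro π hπ
    simp only [Finset.mem_filter_univ] at hπ ⊢
    exact fun C hC => hπ.1 C (Finset.mem_of_mem_erase hC)
  · intro σ hσ
    simp only [Finset.mem_filter_univ] at hσ ⊢
    exact ⟨Finset.forall_mem_insert .. |>.mpr ⟨hpB, hσ⟩, Finset.mem_insert_self ..⟩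
  · intro π hπ
    ext1
    exact Finset.insert_erase (Finset.mem_filter.mp hπ).2.2
  · intro σ _
    ext1
    exact Finset.erase_insert (notMem σ)
  · intro π hπ
    rw [← Finset.card_erase_add_one (Finset.mem_filter.mp hπ).2.2]
    rfl

lemma filter_notMem_parts (π : Finpartition s) (ha : a ∈ s) :
    π.parts.filter (a ∉ ·) = π.parts.erase (π.part a) := by
  ext B
  simp only [Finset.mem_filter, Finset.mem_erase, and_comm (b := B ∈ π.parts)]
  refine and_congr_right fun hB => not_congr ⟨fun haB => (π.part_eq_of_mem hB haB).symm, ?_⟩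
  rintro rfl
  exact π.mem_part_self.mpr ha

lemma factorial_card_parts_sub_one (π : Finpartition s) (ha : a ∈ s) :
    (π.parts.card - 1)! = (if π.parts.card = 1 then 1 else 0) +
      ∑ B ∈ π.parts with a ∉ B, (π.parts.card - 2)! := by
  have hpart : π.part a ∈ π.parts := π.part_mem.mpr ha
  rw [filter_notMem_parts π ha, Finset.sum_const, Finset.card_erase_of_mem hpart, smul_eq_mul]
  obtain h | h : π.parts.card = 1 ∨ 2 ≤ π.parts.card := by
    have := Finset.card_pos.mpr ⟨_, hpart⟩
    omega
  · simp [h]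
  · rw [if_neg (by omega), zero_add, show π.parts.card - 2 = π.parts.card - 1 - 1 by omega,
      Nat.mul_factorial_pred (by omega)]

lemma sum_partitions_card_eq_one (hs : s.Nonempty) :
    ∑ π : Finpartition s with ∀ B ∈ π.parts, p B.card, (if π.parts.card = 1 then 1 else 0) =
      if p s.card then 1 else 0 := by
  have single (π : Finpartition s) :
      ((∀ B ∈ π.parts, p B.card) ∧ π.parts.card = 1) ↔
        p s.card ∧ π = Finpartition.indiscrete hs.ne_empty := by
    constructor
    · rintro ⟨hp, hcard⟩
      obtain ⟨B, hB⟩ := Finset.card_eq_one.mp hcard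
      obtain rfl : B = s := by simpa [hB] using π.sup_parts
      exact ⟨hp _ (by simp [hB]), Finpartition.ext hB⟩
    · rintro ⟨hp, rfl⟩
      simpa using hp
  rw [Finset.sum_boole, Finset.filter_filter, Finset.filter_congr fun π _ => single π]
  split_ifs with hp <;> simp [hp, Finset.filter_eq']

variable {p}

/-- If there are several blocks, let `B` be the one following the block of `a` in the cyclic order;
deleting `B` leaves a cyclically ordered partition of `s \ B`. -/
lemma cyclicPartitionCount_eq (hp : ¬p 0) (ha : a ∈ s) :
    cyclicPartitionCount p s = (if p s.card then 1 else 0) +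
      ∑ B ∈ (s.erase a).powerset, if p B.card then cyclicPartitionCount p (s \ B) else 0 := by
  rw [cyclicPartitionCount, Finset.sum_congr rfl fun π _ => factorial_card_parts_sub_one π ha,
    Finset.sum_add_distrib, sum_partitions_card_eq_one p ⟨a, ha⟩]
  congr 1
  calc ∑ π : Finpartition s with ∀ C ∈ π.parts, p C.card,
        ∑ B ∈ π.parts with a ∉ B, (π.parts.card - 2)!
    _ = ∑ π : Finpartition s with ∀ C ∈ π.parts, p C.card,
        ∑ B ∈ (s.erase a).powerset, if B ∈ π.parts then (π.parts.card - 2)! else 0 := by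
      refine Finset.sum_congr rfl fun π _ => ?_
      rw [← Finset.sum_filter]
      refine Finset.sum_congr (Finset.ext fun B => ?_) fun _ _ => rfl
      simp only [Finset.mem_filter, Finset.mem_powerset, Finset.subset_erase]
      exact ⟨fun h => ⟨⟨π.subset h.1, h.2⟩, h.1⟩, fun h => ⟨h.2, h.1.2⟩⟩
    _ = ∑ B ∈ (s.erase a).powerset, ∑ π : Finpartition s with
        (∀ C ∈ π.parts, p C.card) ∧ B ∈ π.parts, (π.parts.card - 2)! := by
      rw [Finset.sum_comm]
      simp only [← Finset.sum_filter, Finset.filter_filter]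
    _ = ∑ B ∈ (s.erase a).powerset, if p B.card then cyclicPartitionCount p (s \ B) else 0 := by
      refine Finset.sum_congr rfl fun B hB => ?_
      have hBs : B ⊆ s := (Finset.mem_powerset.mp hB).trans (Finset.erase_subset a s)
      split_ifs with hpB
      · have hBne : B.Nonempty := Finset.card_ne_zero.mp fun h0 => hp (h0 ▸ hpB)
        exact sum_partitions_with_block p (fun k => (k - 2)!) hBs hBne hpB
      · refine Finset.sum_eq_zero fun π hπ => ?_
        obtain ⟨hπp, hBπ⟩ := (Finset.mem_filter_univ _).mp hπ
        exact absurd (hπp B hBπ) hpB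

/-- The exponential formula: `w` is the exponential generating function of the admissible block
sizes, and `h` says that `G` is the derivative of `-log (1 - w)`. -/
lemma cyclicPartitionCount_eq_iteratedDeriv {𝕜 : Type*} [NontriviallyNormedField 𝕜]
    [CompleteSpace 𝕜] {w G : 𝕜 → 𝕜} (hp : ¬p 0) (hw : AnalyticAt 𝕜 w 0) (hG : AnalyticAt 𝕜 G 0)
    (hwp : ∀ j, iteratedDeriv j w 0 = if p j then 1 else 0)
    (h : G =ᶠ[𝓝 0] deriv w + w * G) {n : ℕ} (hs : s.card = n + 1) :
    (cyclicPartitionCount p s : 𝕜) = iteratedDeriv n G 0 := by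
  induction n using Nat.strong_induction_on generalizing s with
  | _ n ih =>
  obtain ⟨a, ha⟩ : s.Nonempty := Finset.card_pos.mp (by omega)
  have erase_card : (s.erase a).card = n := by rw [Finset.card_erase_of_mem ha, hs]; rfl
  have summand (B) (hB : B ∈ (s.erase a).powerset) :
      ((if p B.card then cyclicPartitionCount p (s \ B) else 0 : ℕ) : 𝕜) =
        iteratedDeriv B.card w 0 * iteratedDeriv (n - B.card) G 0 := by
    have hBa := Finset.mem_powerset.mp hB
    have hBn : B.card ≤ n := erase_card ▸ Finset.card_le_card hBa
    rw [hwp]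
    split_ifs with hpB
    · have hB0 : B.card ≠ 0 := fun h0 => hp (h0 ▸ hpB)
      rw [one_mul, ih (n - B.card) (by omega)]
      rw [Finset.card_sdiff_of_subset (hBa.trans (Finset.erase_subset a s)), hs]
      omega
    · simp
  rw [h.iteratedDeriv_eq n, iteratedDeriv_add hw.deriv.contDiffAt (hw.mul hG).contDiffAt,
    iteratedDeriv_mul hw.contDiffAt hG.contDiffAt, ← iteratedDeriv_succ', hwp,
    cyclicPartitionCount_eq hp ha, hs, Nat.cast_add, Nat.cast_sum, Finset.sum_congr rfl summand,
    Finset.sum_powerset_apply_card fun k => iteratedDeriv k w 0 * iteratedDeriv (n - k) G 0,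
    erase_card]
  simp only [Nat.cast_ite, Nat.cast_one, Nat.cast_zero, nsmul_eq_mul, mul_assoc]

end SetPartitions

lemma Ccen_eq_cyclicPartitionCount (n : ℕ) :
    Ccen n = cyclicPartitionCount (2 ≤ ·) (Finset.univ : Finset (Fin n)) := by
  unfold Ccen cyclicPartitionCount
  congr!

lemma one_le_Ccen {n : ℕ} (hn : 2 ≤ n) : 1 ≤ Ccen n := by
  have : NeZero n := ⟨by omega⟩
  rw [Ccen_eq_cyclicPartitionCount, cyclicPartitionCount_eq (by norm_num) (Finset.mem_univ 0),
    Finset.card_univ, Fintype.card_fin, if_pos hn]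
  exact Nat.le_add_right 1 _

section DominantPole

lemma iteratedDeriv_const_sub_id_mul {𝕜 : Type*} [NontriviallyNormedField 𝕜] {G : 𝕜 → 𝕜} {c x : 𝕜}
    {n : ℕ} (hG : ContDiffAt 𝕜 (n + 1 : ℕ) G x) :
    iteratedDeriv (n + 1) (fun z => (c - z) * G z) x =
      (c - x) * iteratedDeriv (n + 1) G x - (n + 1) * iteratedDeriv n G x := by
  have high (k : ℕ) : iteratedDeriv (k + 2) (fun z : 𝕜 => c - z) x = 0 := by
    rw [iteratedDeriv_succ']
    simp [iteratedDeriv_const]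
  have hc : ContDiffAt 𝕜 (n + 1 : ℕ) (fun z : 𝕜 => c - z) x := by fun_prop
  change iteratedDeriv (n + 1) ((fun z => c - z) * G) x = _
  rw [iteratedDeriv_mul hc hG, Finset.sum_range_succ', Finset.sum_range_succ']
  have low : iteratedDeriv 1 (fun z : 𝕜 => c - z) x = -1 := by simp [iteratedDeriv_one]
  simp only [high, low, zero_add, iteratedDeriv_zero, zero_mul, mul_zero, Finset.sum_const_zero,
    Nat.choose_zero_right, Nat.choose_one_right, Nat.cast_one, Nat.cast_add, Nat.sub_zero,
    Nat.add_sub_cancel]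
  ring

/-- With `aₙ` the Taylor coefficients of `G`, the product `aₙ * ρ ^ (n + 1)` is a partial sum of the
Taylor series of `g` at `ρ`. -/
lemma tendsto_taylorCoeff_mul_pow_of_simple_pole {G g : ℂ → ℂ} {ρ : ℂ} {R : ℝ} (hρ : ‖ρ‖ < R)
    (hg : DifferentiableOn ℂ g (ball 0 R)) (hG : AnalyticAt ℂ G 0)
    (h : (fun z => (ρ - z) * G z) =ᶠ[𝓝 0] g) :
    Tendsto (fun n => iteratedDeriv n G 0 / n ! * ρ ^ (n + 1)) atTop (𝓝 (g ρ)) := by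
  have hsum := Complex.hasSum_taylorSeries_on_ball hg (mem_ball_zero_iff.mpr hρ)
  have telescope (n : ℕ) : ∑ k ∈ Finset.range (n + 1),
      (k ! : ℂ)⁻¹ • (ρ - 0) ^ k • iteratedDeriv k g 0 =
        iteratedDeriv n G 0 / n ! * ρ ^ (n + 1) := by
    induction n with
    | zero => simp [← h.self_of_nhds, mul_comm]
    | succ n ih =>
      have hn : ((n + 1 : ℕ) : ℂ) ≠ 0 := Nat.cast_ne_zero.mpr n.succ_ne_zero
      rw [Finset.sum_range_succ, ih, ← h.iteratedDeriv_eq,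
        iteratedDeriv_const_sub_id_mul hG.contDiffAt, Nat.factorial_succ]
      push_cast at hn ⊢
      have : (n ! : ℂ) ≠ 0 := Nat.cast_ne_zero.mpr n.factorial_ne_zero
      simp only [sub_zero, smul_eq_mul]
      field_simp
      ring
  exact ((tendsto_add_atTop_iff_nat 1).mpr hsum.tendsto_sum_nat).congr telescope

theorem tendsto_taylorCoeff_div_mul_pow {p q : ℂ → ℂ} {ρ : ℂ} (hp : Differentiable ℂ p)
    (hq : Differentiable ℂ q) (hρ : ρ ≠ 0) (hq' : deriv q ρ ≠ 0)
    (hzero : ∀ z, ‖z‖ ≤ ‖ρ‖ → (q z = 0 ↔ z = ρ)) :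
    Tendsto (fun n => iteratedDeriv n (p / q) 0 / n ! * ρ ^ (n + 1)) atTop
      (𝓝 (-(p ρ / deriv q ρ))) := by
  have hqρ : q ρ = 0 := (hzero ρ le_rfl).mpr rfl
  have hφ : Differentiable ℂ (dslope q ρ) := by
    rw [← differentiableOn_univ, Complex.differentiableOn_dslope univ_mem]
    exact hq.differentiableOn
  have q_eq (z : ℂ) : q z = (z - ρ) * dslope q ρ z := by
    rw [← smul_eq_mul, sub_smul_dslope, hqρ, sub_zero]
  have φ_ne (z : ℂ) (hz : z ∈ closedBall 0 ‖ρ‖) : dslope q ρ z ≠ 0 := by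
    rcases eq_or_ne z ρ with rfl | hzρ
    · rwa [dslope_same]
    · refine right_ne_zero_of_mul (a := z - ρ) ?_
      rw [← q_eq]
      exact fun h => hzρ ((hzero z (mem_closedBall_zero_iff.mp hz)).mp h)
  obtain ⟨δ, hδ, hball⟩ := (isCompact_closedBall (0 : ℂ) ‖ρ‖).exists_thickening_subset_open
    (hφ.continuous.isOpen_preimage _ isOpen_compl_singleton) φ_ne
  rw [thickening_closedBall hδ (norm_nonneg ρ)] at hball
  have hq0 : q 0 ≠ 0 := fun h => hρ ((hzero 0 (by simp)).mp h).symm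
  have hG : AnalyticAt ℂ (p / q) 0 := (hp.analyticAt 0).div (hq.analyticAt 0) hq0
  have key := tendsto_taylorCoeff_mul_pow_of_simple_pole (g := fun z => -(p z / dslope q ρ z))
    (lt_add_of_pos_left ‖ρ‖ hδ)
    (fun z hz =>
      (hp.differentiableAt.div hφ.differentiableAt (hball hz)).neg.differentiableWithinAt) hG ?_
  · simpa only [dslope_same] using key
  · filter_upwards [hq.continuous.continuousAt.eventually_ne hq0] with z hz
    rw [q_eq] at hz
    rw [Pi.div_apply, q_eq]
    have := left_ne_zero_of_mul hz
    have := right_ne_zero_of_mul hz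
    field_simp
    ring

end DominantPole

section CenteredAsymptotics

lemma exp_lt_two_add {x : ℝ} (hx : -rhoCen ≤ x) (hxρ : x < rhoCen) : Real.exp x < 2 + x := by
  have of_nonneg {y : ℝ} (hy : 0 ≤ y) (hyρ : y < rhoCen) : Real.exp y < 2 + y := by
    have exp_lt : rhoCen - y + 1 < Real.exp (rhoCen - y) :=
      Real.add_one_lt_exp (sub_pos.mpr hyρ).ne'
    have exp_mul : Real.exp y * Real.exp (rhoCen - y) = 2 + rhoCen := by
      rw [← Real.exp_add, add_sub_cancel, exp_rhoCen]
    nlinarith [Real.one_le_exp hy]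
  rcases le_or_gt 0 x with hx0 | hx0
  · exact of_nonneg hx0 hxρ
  · have exp_neg_le : Real.exp (-x) ≤ 2 + -x := by
      rcases hx.eq_or_lt with rfl | hx
      · rw [neg_neg, exp_rhoCen]
      · exact (of_nonneg (by linarith) (by linarith)).le
    have sinh_lt : -x < (Real.exp (-x) - Real.exp (-(-x))) / 2 := by
      rw [← Real.sinh_eq, Real.self_lt_sinh_iff]
      exact neg_pos.mpr hx0
    rw [neg_neg] at sinh_lt
    linarith

/-- In the disc `‖2 + z‖ ≥ 2 + re z`, while `‖exp z‖ = exp (re z)` is smaller unless `re z = ρ`. -/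
lemma two_add_sub_exp_eq_zero_iff {z : ℂ} (hz : ‖z‖ ≤ rhoCen) :
    2 + z - Complex.exp z = 0 ↔ z = rhoCen := by
  constructor
  · intro h
    have re_bounds := abs_le.mp ((Complex.abs_re_le_norm z).trans hz)
    have two_add_re_le : 2 + z.re ≤ Real.exp z.re := by
      rw [← Complex.norm_exp, ← sub_eq_zero.mp h]
      simpa using Complex.re_le_norm (2 + z)
    have re_eq : z.re = rhoCen := re_bounds.2.eq_of_not_lt fun hlt =>
      two_add_re_le.not_gt (exp_lt_two_add re_bounds.1 hlt)
    have norm_eq : |z.re| = ‖z‖ := (Complex.abs_re_le_norm z).antisymm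
      (by rwa [re_eq, abs_of_pos rhoCen_pos])
    exact Complex.ext re_eq (Complex.abs_re_eq_norm.mp norm_eq)
  · rintro rfl
    rw [← Complex.ofReal_exp, exp_rhoCen]
    push_cast
    ring

lemma deriv_exp_sub_one_sub_id :
    deriv (fun z : ℂ => Complex.exp z - 1 - z) = fun z => Complex.exp z - 1 := by
  ext z
  simp

lemma iteratedDeriv_exp_sub_one_sub_id (j : ℕ) :
    iteratedDeriv j (fun z : ℂ => Complex.exp z - 1 - z) 0 = if 2 ≤ j then 1 else 0 := by
  match j with
  | 0 => simp
  | 1 => simp [iteratedDeriv_one]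
  | k + 2 => simp [iteratedDeriv_succ', deriv_exp_sub_one_sub_id, iteratedDeriv_eq_iterate]

/-- The exponential generating function of the shifted sequence `n ↦ Ccen (n + 1)`, namely the
derivative of `-log (2 + z - exp z)`. -/
noncomputable def cenGenFun : ℂ → ℂ :=
  (fun z => Complex.exp z - 1) / fun z => 2 + z - Complex.exp z

lemma Ccen_succ_eq_iteratedDeriv (n : ℕ) : (Ccen (n + 1) : ℂ) = iteratedDeriv n cenGenFun 0 := by
  have hden : Continuous fun z : ℂ => 2 + z - Complex.exp z := by fun_prop
  have hden0 : 2 + (0 : ℂ) - Complex.exp 0 ≠ 0 := by norm_num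
  have hG : AnalyticAt ℂ cenGenFun 0 := by
    unfold cenGenFun
    exact (by fun_prop : AnalyticAt ℂ (fun z => Complex.exp z - 1) 0).div (by fun_prop) hden0
  rw [Ccen_eq_cyclicPartitionCount]
  refine cyclicPartitionCount_eq_iteratedDeriv (w := fun z => Complex.exp z - 1 - z)
    (by norm_num) (by fun_prop) hG iteratedDeriv_exp_sub_one_sub_id ?_
    (by rw [Finset.card_univ, Fintype.card_fin])
  filter_upwards [hden.continuousAt.eventually_ne hden0] with z hz
  simp only [cenGenFun, deriv_exp_sub_one_sub_id, Pi.add_apply, Pi.mul_apply, Pi.div_apply]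
  field_simp
  ring

lemma tendsto_Ccen_mul_pow_div_factorial :
    Tendsto (fun n => Ccen n * rhoCen ^ n / (n - 1)! : ℕ → ℝ) atTop (𝓝 1) := by
  have deriv_den : deriv (fun z : ℂ => 2 + z - Complex.exp z) rhoCen = -(1 + rhoCen) := by
    refine (((hasDerivAt_id _).const_add 2).sub (Complex.hasDerivAt_exp _)).deriv.trans ?_
    rw [← Complex.ofReal_exp, exp_rhoCen]
    push_cast
    ring
  have one_add_ne : (1 + rhoCen : ℂ) ≠ 0 := by
    exact_mod_cast (add_pos one_pos rhoCen_pos).ne'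
  have norm_rho : ‖(rhoCen : ℂ)‖ = rhoCen := Complex.norm_of_nonneg rhoCen_pos.le
  have limit := tendsto_taylorCoeff_div_mul_pow (p := fun z => Complex.exp z - 1)
    (q := fun z => 2 + z - Complex.exp z) (ρ := rhoCen) (by fun_prop) (by fun_prop)
    (Complex.ofReal_ne_zero.mpr rhoCen_pos.ne') (deriv_den ▸ neg_ne_zero.mpr one_add_ne)
    fun z hz => two_add_sub_exp_eq_zero_iff (norm_rho ▸ hz)
  have limit_eq : -((Complex.exp rhoCen - 1) / deriv (fun z : ℂ => 2 + z - Complex.exp z) rhoCen)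
      = (1 : ℝ) := by
    rw [deriv_den, ← Complex.ofReal_exp, exp_rhoCen]
    push_cast
    field_simp
    ring
  rw [limit_eq] at limit
  rw [← tendsto_add_atTop_iff_nat 1, ← tendsto_ofReal_iff]
  refine limit.congr fun n => ?_
  change iteratedDeriv n cenGenFun 0 / n ! * (rhoCen : ℂ) ^ (n + 1) = _
  rw [← Ccen_succ_eq_iteratedDeriv, Nat.add_sub_cancel]
  push_cast
  ring

theorem isEquivalent_Ccen :
    Asymptotics.IsEquivalent atTop (fun n => (Ccen n : ℝ))
      (fun n => ((n - 1)! : ℝ) / rhoCen ^ n) := by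
  refine Asymptotics.isEquivalent_of_tendsto_one
    (tendsto_Ccen_mul_pow_div_factorial.congr fun n => ?_)
  rw [Pi.div_apply, div_div_eq_mul_div]

/-- The constant `A_cen` of the tail bound: the least `A ≥ 1` with `Ccen n ≤ A * (n - 1)! / ρ ^ n`
for all `n`. The supremum is finite since the quotients converge. -/
noncomputable def Acen : ℝ :=
  max 1 (⨆ n, Ccen n * rhoCen ^ n / (n - 1)!)

lemma one_le_Acen : 1 ≤ Acen := le_max_left _ _

lemma Ccen_le_Acen_mul (n : ℕ) : (Ccen n : ℝ) ≤ Acen * (n - 1)! / rhoCen ^ n := by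
  rw [le_div_iff₀ (pow_pos rhoCen_pos n), ← div_le_iff₀ (by positivity)]
  exact (le_ciSup tendsto_Ccen_mul_pow_div_factorial.bddAbove_range n).trans (le_max_right _ _)

end CenteredAsymptotics

section CumulantBound

variable {Ω : Type*} [MeasurableSpace Ω] {μ : Measure Ω} [IsProbabilityMeasure μ]

lemma integral_norm_pow_le_rpow {E : Type*} [NormedAddCommGroup E] {f : Ω → E} {k n : ℕ}
    (hf : AEStronglyMeasurable f μ) (hkn : k ≤ n) (hn : Integrable (fun ω => ‖f ω‖ ^ n) μ) :
    ∫ ω, ‖f ω‖ ^ k ∂μ ≤ (∫ ω, ‖f ω‖ ^ n ∂μ) ^ ((k : ℝ) / n) := by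
  rcases k.eq_zero_or_pos with rfl | hk
  · simp
  have hk' : (0 : ℝ) < k := Nat.cast_pos.mpr hk
  have hn' : (0 : ℝ) < n := Nat.cast_pos.mpr (hk.trans_le hkn)
  have rpow_comp : (fun x : ℝ => x ^ ((n : ℝ) / k)) ∘ (fun ω => ‖f ω‖ ^ k) =
      fun ω => ‖f ω‖ ^ n := by
    funext ω
    rw [Function.comp_apply, ← Real.rpow_natCast, ← Real.rpow_mul (norm_nonneg _),
      mul_div_cancel₀ _ hk'.ne', Real.rpow_natCast]
  have jensen : (∫ ω, ‖f ω‖ ^ k ∂μ) ^ ((n : ℝ) / k) ≤ ∫ ω, ‖f ω‖ ^ n ∂μ :=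
    ((convexOn_rpow ((one_le_div hk').mpr (Nat.cast_le.mpr hkn))).map_integral_le
      (Real.continuous_rpow_const (by positivity)).continuousOn isClosed_Ici
      (ae_of_all _ fun ω => Set.mem_Ici.mpr (by positivity))
      (integrable_norm_pow_of_le hf hkn hn) (rpow_comp ▸ hn)).trans_eq
        (congrArg (fun g => ∫ ω, g ω ∂μ) rpow_comp)
  have h0 : 0 ≤ ∫ ω, ‖f ω‖ ^ k ∂μ := integral_nonneg fun ω => by positivity
  calc ∫ ω, ‖f ω‖ ^ k ∂μ = ((∫ ω, ‖f ω‖ ^ k ∂μ) ^ ((n : ℝ) / k)) ^ ((k : ℝ) / n) := by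
        rw [← Real.rpow_mul h0, div_mul_div_cancel₀ hk'.ne', div_self hn'.ne', Real.rpow_one]
    _ ≤ (∫ ω, ‖f ω‖ ^ n ∂μ) ^ ((k : ℝ) / n) := by gcongr

lemma prod_integral_norm_pow_le {E ι : Type*} [NormedAddCommGroup E] {f : Ω → E} {s : Finset ι}
    {k : ι → ℕ} (hf : AEStronglyMeasurable f μ)
    (hint : Integrable (fun ω => ‖f ω‖ ^ ∑ i ∈ s, k i) μ) :
    ∏ i ∈ s, ∫ ω, ‖f ω‖ ^ k i ∂μ ≤ ∫ ω, ‖f ω‖ ^ ∑ i ∈ s, k i ∂μ := by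
  rcases eq_or_ne (∑ i ∈ s, k i) 0 with hn | hn
  · rw [hn, Finset.prod_congr rfl fun i hi => by rw [Finset.sum_eq_zero_iff.mp hn i hi]]
    simp
  set n := ∑ i ∈ s, k i
  have h0 (m : ℕ) : 0 ≤ ∫ ω, ‖f ω‖ ^ m ∂μ := integral_nonneg fun ω => by positivity
  calc ∏ i ∈ s, ∫ ω, ‖f ω‖ ^ k i ∂μ
    _ ≤ ∏ i ∈ s, (∫ ω, ‖f ω‖ ^ n ∂μ) ^ ((k i : ℝ) / n) :=
      Finset.prod_le_prod (fun i _ => h0 (k i)) fun i hi =>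
        integral_norm_pow_le_rpow hf (Finset.single_le_sum_of_canonicallyOrdered hi) hint
    _ = (∫ ω, ‖f ω‖ ^ n ∂μ) ^ (∑ i ∈ s, (k i : ℝ) / n) :=
      (Real.rpow_sum_of_nonneg (h0 n) fun i _ => by positivity).symm
    _ = ∫ ω, ‖f ω‖ ^ n ∂μ := by
      rw [← Finset.sum_div, ← Nat.cast_sum, div_self (Nat.cast_ne_zero.mpr hn), Real.rpow_one]

variable {X : Ω → ℝ}

/-- Since `X` is centred, a partition with a singleton block contributes nothing. -/
theorem abs_cumulant_le {n : ℕ} (hX : AEStronglyMeasurable X μ) (hX0 : ∫ ω, X ω ∂μ = 0)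
    (hn : Integrable (fun ω => |X ω| ^ n) μ) :
    |cumulant X n μ| ≤ Ccen n * ∫ ω, |X ω| ^ n ∂μ := by
  have abs_moment_le (k : ℕ) : |moment X k μ| ≤ ∫ ω, |X ω| ^ k ∂μ := by
    simpa only [moment_def, Pi.pow_apply, abs_pow] using
      abs_integral_le_integral_abs (μ := μ) (f := X ^ k)
  have prod_moments_le (π : Finpartition (Finset.univ : Finset (Fin n))) :
      ∏ B ∈ π.parts, |moment X B.card μ| ≤ ∫ ω, |X ω| ^ n ∂μ := by
    have hsum : ∑ B ∈ π.parts, B.card = n := by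
      rw [π.sum_card_parts, Finset.card_univ, Fintype.card_fin]
    refine (Finset.prod_le_prod (fun _ _ => abs_nonneg _) fun B _ => abs_moment_le B.card).trans ?_
    have lyapunov := prod_integral_norm_pow_le (k := Finset.card) hX (hsum.symm ▸ hn)
    rwa [hsum] at lyapunov
  rw [cumulant, Ccen, Nat.cast_sum, Finset.sum_mul, Finset.sum_filter]
  refine (Finset.abs_sum_le_sum_abs _ _).trans (Finset.sum_le_sum fun π _ => ?_)
  split_ifs with hπ
  · rw [abs_mul, abs_mul, abs_pow, abs_neg, abs_one, one_pow, one_mul, Nat.abs_cast,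
      Finset.abs_prod]
    exact mul_le_mul_of_nonneg_left (prod_moments_le π) (Nat.cast_nonneg _)
  · push Not at hπ
    obtain ⟨B, hB, hB2⟩ := hπ
    have hB1 : B.card = 1 := by
      have := Finset.card_pos.mpr (π.nonempty_of_mem_parts hB)
      omega
    have moment_eq_zero : moment X B.card μ = 0 := by rw [hB1, moment_one, hX0]
    rw [Finset.prod_eq_zero hB moment_eq_zero, mul_zero, abs_zero]

lemma abs_cumulant_le_of_integral_abs_pow_le {n : ℕ} {v L : ℝ} (hX : AEStronglyMeasurable X μ)
    (hX0 : ∫ ω, X ω ∂μ = 0) (hn : 2 ≤ n) (hint : Integrable (fun ω => |X ω| ^ n) μ)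
    (hmom : ∫ ω, |X ω| ^ n ∂μ ≤ v * L ^ (n - 2)) :
    |cumulant X n μ| ≤ (n - 1)! * (Acen * v / rhoCen ^ 2) * (L / rhoCen) ^ (n - 2) := by
  have coeff_nonneg : 0 ≤ Acen * (n - 1)! / rhoCen ^ n :=
    (Nat.cast_nonneg _).trans (Ccen_le_Acen_mul n)
  calc |cumulant X n μ| ≤ Ccen n * ∫ ω, |X ω| ^ n ∂μ := abs_cumulant_le hX hX0 hint
    _ ≤ Acen * (n - 1)! / rhoCen ^ n * (v * L ^ (n - 2)) :=
      mul_le_mul (Ccen_le_Acen_mul n) hmom (integral_nonneg fun ω => by positivity) coeff_nonneg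
    _ = (n - 1)! * (Acen * v / rhoCen ^ 2) * (L / rhoCen) ^ (n - 2) := by
      rw [show rhoCen ^ n = rhoCen ^ 2 * rhoCen ^ (n - 2) by rw [← pow_add, Nat.add_sub_cancel' hn],
        div_pow]
      ring

end CumulantBound

section Bernstein

variable {Ω : Type*} [MeasurableSpace Ω] {μ : Measure Ω} {X : Ω → ℝ} {w b t x : ℝ}

/-- Bernstein's moment condition for a centred random variable, with variance proxy `w` and scale
`b`. All moments are required to be integrable, so that the bounds are not met by the junk value
`0` of a divergent integral. -/
structure HasBernsteinMoments (X : Ω → ℝ) (w b : ℝ) (μ : Measure Ω) : Prop where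
  integrable_pow (n : ℕ) : Integrable (fun ω => X ω ^ n) μ
  integral_eq_zero : ∫ ω, X ω ∂μ = 0
  integral_abs_pow_le (n : ℕ) : ∫ ω, |X ω| ^ (n + 2) ∂μ ≤ (n + 2)! / 2 * w * b ^ n

lemma integrable_of_summable_integral_norm {ι E : Type*} [Countable ι] [NormedAddCommGroup E]
    {F : ι → Ω → E} {f : Ω → E} (hf : AEStronglyMeasurable f μ) (hF : ∀ i, Integrable (F i) μ)
    (hsum : Summable fun i => ∫ ω, ‖F i ω‖ ∂μ) (h : ∀ ω, HasSum (F · ω) (f ω)) :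
    Integrable f μ := by
  refine ⟨hf, ?_⟩
  rw [hasFiniteIntegral_iff_enorm]
  calc ∫⁻ ω, ‖f ω‖ₑ ∂μ
    _ ≤ ∫⁻ ω, ∑' i, ‖F i ω‖ₑ ∂μ := lintegral_mono fun ω => by
      rw [← (h ω).tsum_eq]
      exact enorm_tsum_le_tsum_enorm
    _ = ∑' i, ∫⁻ ω, ‖F i ω‖ₑ ∂μ := lintegral_tsum fun i => (hF i).1.enorm
    _ = ∑' i, ENNReal.ofReal (∫ ω, ‖F i ω‖ ∂μ) :=
      tsum_congr fun i => (ofReal_integral_norm_eq_lintegral_enorm (hF i)).symm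
    _ < ⊤ := hsum.tsum_ofReal_lt_top

namespace HasBernsteinMoments

lemma neg (h : HasBernsteinMoments X w b μ) : HasBernsteinMoments (fun ω => -X ω) w b μ where
  integrable_pow n := by
    simp only [neg_pow (X _)]
    exact (h.integrable_pow n).const_mul _
  integral_eq_zero := by rw [integral_neg, h.integral_eq_zero, neg_zero]
  integral_abs_pow_le := by simpa only [abs_neg] using h.integral_abs_pow_le

lemma integrable_expTerm (h : HasBernsteinMoments X w b μ) (t : ℝ) (n : ℕ) :
    Integrable (fun ω => (t * X ω) ^ n / n !) μ := by
  simp only [mul_pow]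
  exact ((h.integrable_pow n).const_mul _).div_const _

lemma integral_norm_expTerm_le (h : HasBernsteinMoments X w b μ) (t : ℝ) (n : ℕ) :
    ∫ ω, ‖(t * X ω) ^ (n + 2) / (n + 2)!‖ ∂μ ≤ w * t ^ 2 / 2 * (b * |t|) ^ n := by
  calc ∫ ω, ‖(t * X ω) ^ (n + 2) / (n + 2)!‖ ∂μ
    _ = |t| ^ (n + 2) / (n + 2)! * ∫ ω, |X ω| ^ (n + 2) ∂μ := by
      rw [← integral_const_mul]
      refine integral_congr_ae (ae_of_all _ fun ω => ?_)
      simp only [norm_div, norm_pow, norm_mul, Real.norm_eq_abs, mul_pow, Nat.abs_cast]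
      ring
    _ ≤ |t| ^ (n + 2) / (n + 2)! * ((n + 2)! / 2 * w * b ^ n) := by
      gcongr
      exact h.integral_abs_pow_le n
    _ = w * t ^ 2 / 2 * (b * |t|) ^ n := by
      rw [← sq_abs t]
      field_simp
      ring

lemma summable_integral_norm_expTerm (h : HasBernsteinMoments X w b μ) (hb : 0 ≤ b)
    (ht : b * |t| < 1) : Summable fun n => ∫ ω, ‖(t * X ω) ^ n / (n !)‖ ∂μ := by
  rw [← summable_nat_add_iff 2]
  exact Summable.of_nonneg_of_le (fun n => integral_nonneg fun ω => norm_nonneg _)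
    (h.integral_norm_expTerm_le t)
    ((summable_geometric_of_lt_one (by positivity) ht).mul_left _)

lemma integrable_exp_mul (h : HasBernsteinMoments X w b μ) (hb : 0 ≤ b) (ht : b * |t| < 1) :
    Integrable (fun ω => Real.exp (t * X ω)) μ := by
  have hX : AEStronglyMeasurable X μ := by simpa using (h.integrable_pow 1).aestronglyMeasurable
  refine integrable_of_summable_integral_norm
    (Real.continuous_exp.comp_aestronglyMeasurable (hX.const_mul t)) (h.integrable_expTerm t)
    (h.summable_integral_norm_expTerm hb ht) fun ω => ?_
  rw [Real.exp_eq_exp_ℝ]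
  exact NormedSpace.expSeries_div_hasSum_exp (t * X ω)

theorem mgf_le [IsProbabilityMeasure μ] (h : HasBernsteinMoments X w b μ) (hb : 0 ≤ b)
    (ht : b * |t| < 1) : mgf X μ t ≤ Real.exp (w * t ^ 2 / (2 * (1 - b * |t|))) := by
  have mgf_hasSum : HasSum (fun n => ∫ ω, (t * X ω) ^ n / (n !) ∂μ) (mgf X μ t) := by
    simpa only [mgf, Real.exp_eq_exp_ℝ, (NormedSpace.expSeries_div_hasSum_exp _).tsum_eq] using
      hasSum_integral_of_summable_integral_norm (h.integrable_expTerm t)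
        (h.summable_integral_norm_expTerm hb ht)
  have tail_hasSum : HasSum (fun n => ∫ ω, (t * X ω) ^ (n + 2) / (n + 2)! ∂μ)
      (mgf X μ t - 1) := by
    simpa [Finset.sum_range_succ, integral_const_mul, h.integral_eq_zero] using
      (hasSum_nat_add_iff' 2).mpr mgf_hasSum
  have tail_le : mgf X μ t - 1 ≤ w * t ^ 2 / 2 * (1 - b * |t|)⁻¹ :=
    hasSum_le (fun n => (Real.le_norm_self _).trans
      ((norm_integral_le_integral_norm _).trans (h.integral_norm_expTerm_le t n)))
      tail_hasSum ((hasSum_geometric_of_lt_one (by positivity) ht).mul_left _)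
  calc mgf X μ t ≤ w * t ^ 2 / 2 * (1 - b * |t|)⁻¹ + 1 := by linarith
    _ ≤ Real.exp (w * t ^ 2 / 2 * (1 - b * |t|)⁻¹) := Real.add_one_le_exp _
    _ = Real.exp (w * t ^ 2 / (2 * (1 - b * |t|))) := by rw [← div_eq_mul_inv, div_div]

theorem measure_ge_le_exp [IsProbabilityMeasure μ] (h : HasBernsteinMoments X w b μ) (hw : 0 < w)
    (hb : 0 ≤ b) (hx : 0 ≤ x) :
    μ.real {ω | x ≤ X ω} ≤ Real.exp (-(x ^ 2 / (2 * (w + b * x)))) := by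
  have ht : 0 ≤ x / (w + b * x) := by positivity
  have one_sub : 1 - b * |x / (w + b * x)| = w / (w + b * x) := by
    rw [abs_of_nonneg ht]
    field_simp
    ring
  have hbt : b * |x / (w + b * x)| < 1 := sub_pos.mp (one_sub ▸ by positivity)
  calc μ.real {ω | x ≤ X ω}
    _ ≤ Real.exp (-(x / (w + b * x)) * x) * mgf X μ (x / (w + b * x)) :=
      measure_ge_le_exp_mul_mgf x ht (h.integrable_exp_mul hb hbt)
    _ ≤ Real.exp (-(x / (w + b * x)) * x) *
        Real.exp (w * (x / (w + b * x)) ^ 2 / (2 * (w / (w + b * x)))) := by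
      gcongr
      exact one_sub ▸ h.mgf_le hb hbt
    _ = Real.exp (-(x ^ 2 / (2 * (w + b * x)))) := by
      rw [← Real.exp_add]
      congr 1
      field_simp
      ring

theorem measure_abs_ge_le_exp [IsProbabilityMeasure μ] (h : HasBernsteinMoments X w b μ)
    (hw : 0 < w) (hb : 0 ≤ b) (hx : 0 ≤ x) :
    μ.real {ω | x ≤ |X ω|} ≤ 2 * Real.exp (-(x ^ 2 / (2 * (w + b * x)))) := by
  calc μ.real {ω | x ≤ |X ω|}
    _ = μ.real ({ω | x ≤ X ω} ∪ {ω | x ≤ -X ω}) := by simp only [le_abs, Set.ofPred_or]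
    _ ≤ μ.real {ω | x ≤ X ω} + μ.real {ω | x ≤ -X ω} := measureReal_union_le _ _
    _ ≤ 2 * Real.exp (-(x ^ 2 / (2 * (w + b * x)))) := by
      rw [two_mul]
      exact add_le_add (h.measure_ge_le_exp hw hb hx) (h.neg.measure_ge_le_exp hw hb hx)

end HasBernsteinMoments

lemma rhoCen_pow_le_Acen_mul_factorial (n : ℕ) : rhoCen ^ (n + 2) ≤ Acen * ((n + 2)! / 2) := by
  have one_le : 1 ≤ Acen * (n + 1)! / rhoCen ^ (n + 2) :=
    le_trans (by exact_mod_cast one_le_Ccen (Nat.le_add_left 2 n)) (Ccen_le_Acen_mul (n + 2))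
  rw [one_le_div (pow_pos rhoCen_pos _)] at one_le
  have factorial_le : ((n + 1)! : ℝ) ≤ (n + 2)! / 2 := by
    rw [Nat.factorial_succ (n + 1)]
    push_cast
    nlinarith [mul_nonneg (n.cast_nonneg (α := ℝ)) ((n + 1)!.cast_nonneg (α := ℝ))]
  exact one_le.trans (mul_le_mul_of_nonneg_left factorial_le (zero_le_one.trans one_le_Acen))

lemma hasBernsteinMoments_of_integral_abs_pow_le [IsFiniteMeasure μ] {v L : ℝ}
    (hX : AEStronglyMeasurable X μ) (hX0 : ∫ ω, X ω ∂μ = 0) (hv : 0 ≤ v) (hL : 0 ≤ L)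
    (h : ∀ n, 2 ≤ n → Integrable (fun ω => |X ω| ^ n) μ ∧
      ∫ ω, |X ω| ^ n ∂μ ≤ v * L ^ (n - 2)) :
    HasBernsteinMoments X (Acen * v / rhoCen ^ 2) (L / rhoCen) μ where
  integrable_pow n := by
    refine (integrable_norm_iff (hX.pow n)).mp ?_
    simp only [Pi.pow_apply, norm_pow]
    exact integrable_norm_pow_of_le hX (Nat.le_add_right n 2) (h (n + 2) (Nat.le_add_left 2 n)).1
  integral_eq_zero := hX0
  integral_abs_pow_le n := by
    have hρ := rhoCen_pos
    calc ∫ ω, |X ω| ^ (n + 2) ∂μ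
      _ ≤ v * L ^ n := (h (n + 2) (Nat.le_add_left 2 n)).2
      _ ≤ Acen * ((n + 2)! / 2) / rhoCen ^ (n + 2) * (v * L ^ n) :=
        le_mul_of_one_le_left (by positivity)
          ((one_le_div (by positivity)).mpr (rhoCen_pow_le_Acen_mul_factorial n))
      _ = (n + 2)! / 2 * (Acen * v / rhoCen ^ 2) * (L / rhoCen) ^ n := by
        rw [pow_add, div_pow]
        ring

end Bernstein

end CumulantBounds

theorem corollary8p4 :
    Asymptotics.IsEquivalent atTop (fun n : ℕ => (CumulantBounds.Ccen n : ℝ))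
      (fun n : ℕ => ((n - 1).factorial : ℝ) / CumulantBounds.rhoCen ^ n) ∧
    ∃ A : ℝ, 1 ≤ A ∧
      ∀ (Ω : Type*) [MeasurableSpace Ω] (μ : Measure Ω) [IsProbabilityMeasure μ]
        (X : Ω → ℝ) (v : ℝ),
        MemLp X 2 μ → ∫ ω, X ω ∂μ = 0 → variance X μ = v → 0 < v →
        (∀ n : ℕ, 2 ≤ n → Integrable (fun ω => |X ω| ^ n) μ →
          |CumulantBounds.cumulant X n μ| ≤
            (CumulantBounds.Ccen n : ℝ) * ∫ ω, |X ω| ^ n ∂μ) ∧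
        ∀ L : ℝ, 0 < L →
          (∀ n : ℕ, 2 ≤ n → Integrable (fun ω => |X ω| ^ n) μ ∧
            ∫ ω, |X ω| ^ n ∂μ ≤ v * L ^ (n - 2)) →
          (∀ n : ℕ, 2 ≤ n →
            |CumulantBounds.cumulant X n μ| ≤
              ((n - 1).factorial : ℝ) * (A * v / CumulantBounds.rhoCen ^ 2) *
                (L / CumulantBounds.rhoCen) ^ (n - 2)) ∧
          ∀ x : ℝ, 0 < x →
            μ.real {ω | x ≤ |X ω|} ≤
              2 * Real.exp (-(x ^ 2 / (2 * (A * v / CumulantBounds.rhoCen ^ 2 +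
                (L / CumulantBounds.rhoCen) * x)))) := by
  refine ⟨CumulantBounds.isEquivalent_Ccen, CumulantBounds.Acen, CumulantBounds.one_le_Acen,
    fun Ω _ μ _ X v hX hX0 _ hv => ?_⟩
  refine ⟨fun n _ hn => CumulantBounds.abs_cumulant_le hX.1 hX0 hn, fun L hL h => ⟨fun n hn => ?_,
    fun x hx => ?_⟩⟩
  · exact CumulantBounds.abs_cumulant_le_of_integral_abs_pow_le hX.1 hX0 hn (h n hn).1 (h n hn).2
  · have hw : 0 < CumulantBounds.Acen * v / CumulantBounds.rhoCen ^ 2 :=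
      div_pos (mul_pos (one_pos.trans_le CumulantBounds.one_le_Acen) hv)
        (pow_pos CumulantBounds.rhoCen_pos 2)
    exact (CumulantBounds.hasBernsteinMoments_of_integral_abs_pow_le hX.1 hX0 hv.le hL.le
      h).measure_abs_ge_le_exp hw (div_pos hL CumulantBounds.rhoCen_pos).le hx.le
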